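/- **Conventions.** Let $\mathbb F_q$ be a finite field of characteristic $p$. A linear code with parameters $[n,k,d]_q$ is a subspace of $\mathbb F_q^n$ of dimension $k\ge 1$ whose minimum Hamming distance is $d$. Let $C^{\perp}=\{b\in\mathbb F_q^n : \langle c,b\rangle=\sum_i c_ib_i=0 \text{ for all } c\in C\}$ be the Euclidean dual. For $S\subseteq\mathbb F_q^n$, $\mathrm{wgt}(S)$ is the minimum Hamming weight of the nonzero vectors in $S$ and $d(S)$ is the minimum Hamming distance of two distinct vectors in $S$; either quantity is defined to be $n$ if the minimum is over the empty set. Let $\omega=e^{2\pi i/p}$, and on $(\mathbb C^q)^{\otimes N}$ with basis $|x\rangle$, $x\in\mathbb F_q^N$, let $X(a)|x\rangle=|x+a\rangle$ and $Z(b)|x\rangle=\omega^{\mathrm{tr}\langle b,x\rangle}|x\rangle$, where $\mathrm{tr}$ is the absolute trace. The weight of $X(a)Z(b)$ is the number of $i$ with $(a_i,b_i)\ne(0,0)$. A stabilizer code is a nonzero subspace $\mathcal Q\subseteq(\mathbb C^q)^{\otimes N}$ consisting of all the vectors fixed by some subgroup of the error group $\{\omega^cX(a)Z(b) : c\in\mathbb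 F_p,\ a,b\in\mathbb F_q^N\}$. It is an $[\![N,k,d]\!]_q$ code if $\dim\mathcal Q=q^k$ and its minimum distance $d(\mathcal Q)$ equals $d$, where $d(\mathcal Q)$ is the largest $m$ such that every linear operator $E$ acting on at most $m-1$ tensor factors is detected, i.e. $PEP=\lambda_E P$ for some scalar $\lambda_E$, with $P$ the orthogonal projection onto $\mathcal Q$; if $\dim\mathcal Q=1$, it is required in addition (as usual) that $P\,X(a)Z(b)\,P=0$ whenever the weight of $X(a)Z(b)$ lies between $1$ and $m-1$. **Theorem.** Let $C_1,C_2\subseteq\mathbb F_q^n$ be linear codes with parameters $[n,k_1,d_1]_q$ and $[n,k_2,d_2]_q$. Put $e=n-k_2-\dim(C_1\cap C_2^{\perp})$. Then also $e=n-k_1-\dim(C_2\cap C_1^{\perp})$, the number $k=k_1+k_2-n+e$ is nonnegative, and there is an $[\![n+e,\,k,\,d(\mathcal Q)]\!]_q$ stabilizer code $\mathcal Q$ such that, with $$\begin{aligned}\delta=\min\bigl\{&\mathrm{wgt}\bigl(C_1\setminus(C_1\cap C_2^{\perp})\bigr),\ \mathrm{wgt}\bigl(C_2\setminus(C_2\cap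 C_1^{\perp})\bigr),\\ &\mathrm{wgt}\bigl((C_1+C_2^{\perp})\setminus C_2^{\perp}\bigr)+1,\ \mathrm{wgt}\bigl((C_2+C_1^{\perp})\setminus C_1^{\perp}\bigr)+1\bigr\}\end{aligned}$$ and $$\delta'=\min\bigl\{d_1,\ d_2,\ d(C_1+C_2^{\perp})+1,\ d(C_2+C_1^{\perp})+1\bigr\},$$ the following hold: $d(\mathcal Q)\ge\delta$ if $k\ge1$; $\delta\ge\delta'$ and $d(\mathcal Q)\ge\delta'$ (also if $k=0$); and $$d(\mathcal Q)\le\min\bigl\{\mathrm{wgt}\bigl(C_1\setminus(C_1\cap C_2^{\perp})\bigr),\ \mathrm{wgt}\bigl(C_2\setminus(C_2\cap C_1^{\perp})\bigr)\bigr\}.$$ -/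

import Mathlib

open scoped Matrix

noncomputable section

namespace QCode

/-! ### Classical linear codes -/

section Classical

variable {F : Type*} [Field F] [DecidableEq F] {n : ℕ}

/-- The Euclidean dual `C^⊥ = {b | ⟨c, b⟩ = 0 for all c ∈ C}` of a linear code. -/
def dual (C : Submodule F (Fin n → F)) : Submodule F (Fin n → F) where
  carrier := {b | ∀ c ∈ C, c ⬝ᵥ b = 0}
  add_mem' := by
    intro a b ha hb c hc
    rw [dotProduct_add, ha c hc, hb c hc, add_zero]
  zero_mem' := by
    intro c _
    exact dotProduct_zero c
  smul_mem' := by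
    intro r b hb c hc
    rw [dotProduct_smul, hb c hc, smul_zero]

open Classical in
/-- `wgt(S)`: the minimum Hamming weight of the nonzero vectors in `S`, and `n` if there are none. -/
def minWeight (S : Set (Fin n → F)) : ℕ :=
  if ∃ x ∈ S, x ≠ 0 then sInf {w | ∃ x ∈ S, x ≠ 0 ∧ hammingNorm x = w} else n

open Classical in
/-- `d(S)`: the minimum Hamming distance of two distinct vectors in `S`, and `n` if there is
no such pair. -/
def minDist (S : Set (Fin n → F)) : ℕ :=
  if ∃ x ∈ S, ∃ y ∈ S, x ≠ y then
    sInf {w | ∃ x ∈ S, ∃ y ∈ S, x ≠ y ∧ hammingDist x y = w}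
  else n

/-- `C` is a linear code with parameters `[n, k, d]`. The dimension is positive. -/
structure IsLinearCode (C : Submodule F (Fin n → F)) (k d : ℕ) : Prop where
  dim_pos : 0 < k
  dim_eq : Module.finrank F C = k
  dist_eq : minWeight (C : Set (Fin n → F)) = d

end Classical

/-! ### Quantum codes

The space `(ℂ^q)^{⊗N}` is the space of functions `(Fin N → F) → ℂ`, where `F` is the field with
`q` elements. The computational basis vector `|x₁⟩ ⊗ ⋯ ⊗ |x_N⟩` is the indicator function of
`x ∈ F^N`. Operators are matrices indexed by `F^N`, and the Hermitian inner product is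
`⟨u, v⟩ = star u ⬝ᵥ v`. -/

section Quantum

variable (F : Type*) [Field F] [Fintype F]

instance instNeZeroRingChar : NeZero (ringChar F) :=
  ⟨CharP.ringChar_ne_zero_of_finite F⟩

/-- The additive character `x ↦ ω ^ tr(x)` of the finite field `F`, where `ω = exp(2πi/p)`, `p` is
the characteristic of `F`, and `tr` is the absolute trace to `𝔽_p`. -/
def psi : AddChar F ℂ :=
  letI : Algebra (ZMod (ringChar F)) F := ZMod.algebra F (ringChar F)
  (ZMod.stdAddChar (N := ringChar F)).compAddMonoidHom
    (Algebra.trace (ZMod (ringChar F)) F).toAddMonoidHom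

variable {F} [DecidableEq F] {N : ℕ}

/-- The shift operator `X(a)|x⟩ = |x + a⟩`. -/
def opX (a : Fin N → F) : Matrix (Fin N → F) (Fin N → F) ℂ :=
  Matrix.of fun x y => if x = y + a then 1 else 0

/-- The phase operator `Z(b)|x⟩ = ω ^ tr(⟨b, x⟩) |x⟩`. -/
def opZ (b : Fin N → F) : Matrix (Fin N → F) (Fin N → F) ℂ :=
  Matrix.diagonal fun x => psi F (b ⬝ᵥ x)

/-- The elements `ω ^ c X(a) Z(b)` of the error group, where `c ∈ 𝔽_p` and `a, b ∈ F^N`. -/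
def IsErrorGroupElement (E : Matrix (Fin N → F) (Fin N → F) ℂ) : Prop :=
  ∃ (c : ZMod (ringChar F)) (a b : Fin N → F), E = ZMod.stdAddChar c • (opX a * opZ b)

/-- The symplectic weight of `(a|b)`. -/
def swt (a b : Fin N → F) : ℕ :=
  (Finset.univ.filter fun i => (a i, b i) ≠ (0, 0)).card

/-- A stabilizer code: a nonzero subspace that consists of all the vectors fixed by some subgroup
`S` of the error group. -/
def IsStabilizerCode (Q : Submodule ℂ ((Fin N → F) → ℂ)) : Prop :=
  Q ≠ ⊥ ∧ ∃ S : Subgroup (Matrix.unitaryGroup (Fin N → F) ℂ),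
    (∀ U ∈ S, IsErrorGroupElement (U : Matrix (Fin N → F) (Fin N → F) ℂ)) ∧
    ∀ v, v ∈ Q ↔ ∀ U ∈ S, (U : Matrix (Fin N → F) (Fin N → F) ℂ) *ᵥ v = v

/-- `E` acts on the tensor factors in `T` only, i.e. it is the tensor product of an operator `A` on
these factors with the identity on all the other factors. -/
def ActsOn (T : Finset (Fin N)) (E : Matrix (Fin N → F) (Fin N → F) ℂ) : Prop :=
  ∃ A : Matrix (T → F) (T → F) ℂ, ∀ x y : Fin N → F,
    E x y = if ∀ i, i ∉ T → x i = y i then A (fun i => x i) (fun i => y i) else 0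

/-- The code `Q` detects the error `E` (or `E` has no effect on `Q`): `P E P = c P` for some scalar
`c`, where `P` is the orthogonal projection onto `Q`. -/
def Detects (Q : Submodule ℂ ((Fin N → F) → ℂ)) (E : Matrix (Fin N → F) (Fin N → F) ℂ) : Prop :=
  ∃ c : ℂ, ∀ u ∈ Q, ∀ v ∈ Q, star u ⬝ᵥ (E *ᵥ v) = c * (star u ⬝ᵥ v)

/-- The minimum distance of `Q` is at least `d`: every error that acts on at most `d - 1` tensor
factors is detected. As this is vacuous for a code of dimension one, such a code is required to be
pure, as usual: the operators `X(a)Z(b)` of weight between `1` and `d - 1` map the code to its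
orthogonal complement. (So the minimum distance of a one-dimensional stabilizer code is the minimum
weight of the non-scalar elements of its stabilizer.) -/
def DistanceAtLeast (Q : Submodule ℂ ((Fin N → F) → ℂ)) (d : ℕ) : Prop :=
  (∀ T : Finset (Fin N), T.card < d → ∀ E, ActsOn T E → Detects Q E) ∧
  (Module.finrank ℂ Q = 1 → ∀ a b : Fin N → F, 0 < swt a b → swt a b < d →
    ∀ u ∈ Q, ∀ v ∈ Q, star u ⬝ᵥ ((opX a * opZ b) *ᵥ v) = 0)

/-- `Q` is an `[[N, k, d]]_q` stabilizer code, where `q = |F|`. The number `d` is the exact value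
of the minimum distance. -/
structure IsStabilizerCodeWith (Q : Submodule ℂ ((Fin N → F) → ℂ)) (k d : ℕ) : Prop where
  stabilizer : IsStabilizerCode Q
  dim_eq : Module.finrank ℂ Q = Fintype.card F ^ k
  dist_eq : IsGreatest {m | DistanceAtLeast Q m} d

end Quantum

end QCode

end

/-! This is construction X for CSS codes. The spaces `C₁` and `C₂^⊥` need not be nested, and `e` is
the dimension of `C₂^⊥ / (C₁ ∩ C₂^⊥)`, the failure of `C₂^⊥ ≤ C₁`. Choose a linear map `φ` from
`C₂^⊥` onto `F^e` with kernel `C₁ ∩ C₂^⊥`, and put `A = {(x | φ x) : x ∈ C₂^⊥}` and `D = A + (C₁ |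
0)`. Now `A ≤ D`, and the CSS code of this pair has dimension `q^k` with `k = dim D - dim A = dim C₁
- dim (C₁ ∩ C₂^⊥)`.

If `k ≥ 1`, its distance is governed by the words of `D \ A` and of `A^⊥ \ D^⊥` (`detects_css`).
Such a word `(u | v)` with `v = 0` has `u` in `C₁ \ C₂^⊥`, respectively `C₂ \ C₁^⊥`. If `v ≠ 0`, the
tail adds at least one to the weight, while `u` lies in `(C₁ + C₂^⊥) \ C₂^⊥`, respectively `(C₂ +
C₁^⊥) \ C₁^⊥`, since `(C₁ ∩ C₂^⊥)^⊥ = C₂ + C₁^⊥`. Conversely, padding words of `C₁ \ C₂^⊥` and `C₂ \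
C₁^⊥` with zeros gives undetected errors, hence the upper bound.

If `k = 0`, then `A = D`, and purity requires bounds on all nonzero words of `A` and `A^⊥`. Here
surjectivity of `φ` excludes words `(0 | v)` with `v ≠ 0` from `A^⊥`. -/

noncomputable section

set_option linter.unusedSectionVars false

namespace QCode

/-! ### Euclidean duality -/

section DualCode

variable {F : Type*} [Field F] {n : ℕ}

theorem mem_dual {C : Submodule F (Fin n → F)} {b : Fin n → F} :
    b ∈ dual C ↔ ∀ c ∈ C, c ⬝ᵥ b = 0 := Iff.rfl

theorem dual_eq_orthogonal (C : Submodule F (Fin n → F)) :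
    dual C = LinearMap.BilinForm.orthogonal (dotProductBilin F F) C := rfl

theorem dotProductBilin_isRefl :
    LinearMap.IsRefl (dotProductBilin F F : LinearMap.BilinForm F (Fin n → F)) := by
  intro x y h
  change y ⬝ᵥ x = 0
  rw [dotProduct_comm]
  exact h

theorem dotProductBilin_nondegenerate :
    LinearMap.BilinForm.Nondegenerate
      (dotProductBilin F F : LinearMap.BilinForm F (Fin n → F)) := by
  refine (LinearMap.IsRefl.nondegenerate_iff_separatingLeft dotProductBilin_isRefl).2 ?_
  intro x hx
  exact dotProduct_eq_zero x hx

theorem dual_dual (C : Submodule F (Fin n → F)) : dual (dual C) = C := by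
  rw [dual_eq_orthogonal, dual_eq_orthogonal]
  exact LinearMap.BilinForm.orthogonal_orthogonal dotProductBilin_nondegenerate
    (fun _ _ => dotProductBilin_isRefl _ _) C

theorem finrank_add_finrank_dual (C : Submodule F (Fin n → F)) :
    Module.finrank F C + Module.finrank F (dual C) = n := by
  have h := LinearMap.BilinForm.finrank_orthogonal (B := dotProductBilin F F)
    dotProductBilin_nondegenerate C
  have h' := Submodule.finrank_le C
  rw [dual_eq_orthogonal, h]
  rw [Module.finrank_fin_fun] at *
  omega

theorem dual_le_dual {C D : Submodule F (Fin n → F)} (h : C ≤ D) : dual D ≤ dual C :=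
  fun _ hb c hc => hb c (h hc)

theorem dual_sup (C D : Submodule F (Fin n → F)) : dual (C ⊔ D) = dual C ⊓ dual D := by
  refine le_antisymm (le_inf (dual_le_dual le_sup_left) (dual_le_dual le_sup_right)) ?_
  rintro b ⟨hC, hD⟩ x hx
  obtain ⟨c, hc, d, hd, rfl⟩ := Submodule.mem_sup.1 hx
  rw [add_dotProduct, hC c hc, hD d hd, add_zero]

theorem dual_inf (C D : Submodule F (Fin n → F)) : dual (C ⊓ D) = dual C ⊔ dual D := by
  rw [← dual_dual (dual C ⊔ dual D), dual_sup, dual_dual, dual_dual]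

theorem exists_dotProduct_ne_zero {C : Submodule F (Fin n → F)} {x : Fin n → F} (hx : x ∉ C) :
    ∃ b ∈ dual C, b ⬝ᵥ x ≠ 0 := by
  rw [← dual_dual C, mem_dual] at hx
  push Not at hx
  exact hx

end DualCode

/-! ### The additive character of the field -/

section Character

variable {F : Type*} [Field F] [Fintype F]

/-- The trace is surjective, and the standard character of `ZMod p` is injective. -/
theorem exists_psi_ne_one : ∃ t : F, psi F t ≠ 1 := by
  have : Fact (ringChar F).Prime := ⟨CharP.char_is_prime F (ringChar F)⟩
  let : Algebra (ZMod (ringChar F)) F := ZMod.algebra F (ringChar F)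
  obtain ⟨t, ht⟩ := Algebra.trace_surjective (ZMod (ringChar F)) F 1
  refine ⟨t, fun h => ?_⟩
  have h' : ZMod.stdAddChar (Algebra.trace (ZMod (ringChar F)) F t) = 1 := h
  rw [ht, ← AddChar.map_zero_eq_one (ZMod.stdAddChar (N := ringChar F))] at h'
  exact one_ne_zero (ZMod.injective_stdAddChar h')

theorem exists_psi_dotProduct_ne_one {n : ℕ} {C : Submodule F (Fin n → F)} {b x : Fin n → F}
    (hb : b ∈ C) (h : b ⬝ᵥ x ≠ 0) : ∃ b' ∈ C, psi F (b' ⬝ᵥ x) ≠ 1 := by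
  obtain ⟨t, ht⟩ := exists_psi_ne_one (F := F)
  refine ⟨(t / (b ⬝ᵥ x)) • b, C.smul_mem _ hb, ?_⟩
  rwa [smul_dotProduct, smul_eq_mul, div_mul_cancel₀ _ h]

theorem star_psi (t : F) : star (psi F t) = psi F (-t) := by
  rw [AddChar.map_neg_eq_conj]; rfl

end Character

/-! ### Products, adjoints and supports of error operators -/

section PauliOperators

variable {F : Type*} [Field F] [Fintype F] [DecidableEq F] {N : ℕ}

theorem opX_mul_opZ_apply (a b x y : Fin N → F) :
    (opX a * opZ b) x y = if x = y + a then psi F (b ⬝ᵥ y) else 0 := by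
  simp [opX, opZ, Matrix.mul_diagonal]

theorem opX_mul_opZ_mulVec (a b : Fin N → F) (v : (Fin N → F) → ℂ) (x : Fin N → F) :
    ((opX a * opZ b) *ᵥ v) x = psi F (b ⬝ᵥ (x - a)) * v (x - a) := by
  simp only [Matrix.mulVec, dotProduct, opX_mul_opZ_apply]
  rw [Finset.sum_eq_single (x - a)]
  · simp
  · intro y _ hy
    rw [if_neg, zero_mul]
    rintro rfl
    simp at hy
  · simp

theorem opX_mul_opZ_mul (a b a' b' : Fin N → F) :
    (opX a * opZ b) * (opX a' * opZ b') =
      psi F (b ⬝ᵥ a') • (opX (a + a') * opZ (b + b')) := by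
  ext x y
  rw [Matrix.mul_apply, Finset.sum_eq_single (y + a')]
  · simp only [Matrix.smul_apply, opX_mul_opZ_apply, smul_eq_mul, if_true]
    have : y + a' + a = y + (a + a') := by abel
    rw [this]
    split_ifs
    · rw [← AddChar.map_add_eq_mul, ← AddChar.map_add_eq_mul, dotProduct_add, add_dotProduct]
      congr 1
      ring
    · simp
  · intro z _ hz
    rw [opX_mul_opZ_apply a' b', if_neg hz, mul_zero]
  · simp

theorem opX_zero_mul_opZ_zero : (opX (0 : Fin N → F) * opZ 0) = 1 := by
  ext x y
  simp [opX_mul_opZ_apply, Matrix.one_apply]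

theorem star_opX_mul_opZ (a b : Fin N → F) :
    star (opX a * opZ b) = psi F (b ⬝ᵥ a) • (opX (-a) * opZ (-b)) := by
  ext x y
  rw [Matrix.star_apply, Matrix.smul_apply, opX_mul_opZ_apply, opX_mul_opZ_apply]
  by_cases h : y = x + a
  · have h' : x = y + -a := by rw [h]; abel
    rw [if_pos h, if_pos h', star_psi, smul_eq_mul, ← AddChar.map_add_eq_mul, h, neg_dotProduct,
      dotProduct_add]
    congr 1
    ring
  · have h' : ¬ x = y + -a := by
      rintro rfl
      apply h
      abel
    rw [if_neg h, if_neg h']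
    simp

theorem opX_mul_opZ_mem_unitaryGroup (a b : Fin N → F) :
    opX a * opZ b ∈ Matrix.unitaryGroup (Fin N → F) ℂ := by
  rw [Matrix.mem_unitaryGroup_iff, star_opX_mul_opZ, mul_smul_comm, opX_mul_opZ_mul,
    smul_smul, ← AddChar.map_add_eq_mul, add_neg_cancel, add_neg_cancel, opX_zero_mul_opZ_zero,
    dotProduct_neg, add_neg_cancel, AddChar.map_zero_eq_one, one_smul]

/-- `X(a)Z(b)` acts on the support of `a` and `b`. -/
theorem actsOn_opX_mul_opZ (a b : Fin N → F) (T : Finset (Fin N))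
    (ha : ∀ i, i ∉ T → a i = 0) (hb : ∀ i, i ∉ T → b i = 0) : ActsOn T (opX a * opZ b) := by
  refine ⟨Matrix.of fun x y => if x = y + (fun i : T => a i) then
    psi F ((fun i : T => b i) ⬝ᵥ y) else 0,
    fun x y => ?_⟩
  rw [opX_mul_opZ_apply]
  have hdot : b ⬝ᵥ y = (fun i : T => b i) ⬝ᵥ (fun i : T => y i) := by
    simp only [dotProduct]
    rw [Finset.sum_coe_sort T (fun i => b i * y i)]
    refine (Finset.sum_subset (Finset.subset_univ T) fun i _ hi => ?_).symm
    rw [hb i hi, zero_mul]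
  by_cases h : x = y + a
  · subst h
    rw [if_pos rfl, if_pos, Matrix.of_apply, if_pos, hdot]
    · ext i; simp
    · intro i hi; simp [ha i hi]
  · rw [if_neg h]
    split_ifs with h1
    · rw [Matrix.of_apply, if_neg]
      intro h2
      apply h
      ext i
      by_cases hi : i ∈ T
      · exact congrFun h2 ⟨i, hi⟩
      · simp [h1 i hi, ha i hi]
    · rfl

end PauliOperators

/-! ### CSS codes: stabilizer, dimension and distance -/

section CSS

variable {F : Type*} [Field F] [Fintype F] [DecidableEq F] {N : ℕ}

/-- The CSS code of `A ≤ D`: the functions on `F^N` that vanish outside `D` and are invariant under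
translation by `A`. -/
def css (A D : Submodule F (Fin N → F)) : Submodule ℂ ((Fin N → F) → ℂ) where
  carrier := {f | (∀ x, x ∉ D → f x = 0) ∧ ∀ a ∈ A, ∀ x, f (x + a) = f x}
  add_mem' := by
    rintro f g ⟨hf, hf'⟩ ⟨hg, hg'⟩
    exact ⟨fun x hx => by simp [hf x hx, hg x hx],
      fun a ha x => by simp [hf' a ha x, hg' a ha x]⟩
  zero_mem' := by simp
  smul_mem' := by
    rintro c f ⟨hf, hf'⟩
    exact ⟨fun x hx => by simp [hf x hx], fun a ha x => by simp [hf' a ha x]⟩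

variable {A D : Submodule F (Fin N → F)}

theorem css_sub {f : (Fin N → F) → ℂ} (hf : f ∈ css A D) {a : Fin N → F} (ha : a ∈ A)
    (x : Fin N → F) : f (x - a) = f x := by
  rw [sub_eq_add_neg, hf.2 _ (A.neg_mem ha)]

open Classical in
/-- The indicator function of the coset `w + A`. -/
def cosetVec (A : Submodule F (Fin N → F)) (w : Fin N → F) : (Fin N → F) → ℂ :=
  fun x => if x - w ∈ A then 1 else 0

theorem cosetVec_self (w : Fin N → F) : cosetVec A w w = 1 := by simp [cosetVec]

theorem cosetVec_mem_css (hAD : A ≤ D) {w : Fin N → F} (hw : w ∈ D) : cosetVec A w ∈ css A D := by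
  constructor
  · intro x hx
    refine if_neg fun h => hx ?_
    have := D.add_mem (hAD h) hw
    rwa [sub_add_cancel] at this
  · intro a ha x
    have : x + a - w = (x - w) + a := by abel
    simp only [cosetVec]
    rw [this, A.add_mem_iff_left ha]

open scoped ComplexOrder in
theorem star_cosetVec_dotProduct_self_ne_zero (w : Fin N → F) :
    star (cosetVec A w) ⬝ᵥ cosetVec A w ≠ 0 := by
  intro h
  have := dotProduct_star_self_eq_zero.1 h
  have h1 := cosetVec_self (A := A) w
  rw [this] at h1
  exact zero_ne_one h1

theorem css_ne_bot (hAD : A ≤ D) : css A D ≠ ⊥ := by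
  intro h
  have h1 := cosetVec_mem_css hAD D.zero_mem
  rw [h, Submodule.mem_bot] at h1
  have h2 := cosetVec_self (A := A) 0
  rw [h1] at h2
  exact zero_ne_one h2

/-- The stabilizer consists of the `X(a)Z(b)` with `a ∈ A` and `b ∈ D^⊥`. Since `A ≤ D`, all the
phases `ψ(⟨b, a⟩)` are trivial, so these operators form a group. Invariance under the `Z(b)` forces
the support into `D`, and invariance under the `X(a)` is invariance under translation by `A`. -/
theorem isStabilizerCode_css (hAD : A ≤ D) : IsStabilizerCode (css A D) := by
  refine ⟨css_ne_bot hAD, ?_⟩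
  have horth : ∀ a ∈ A, ∀ b ∈ dual D, b ⬝ᵥ a = 0 := fun a ha b hb => by
    rw [dotProduct_comm]; exact hb a (hAD ha)
  let S : Subgroup (Matrix.unitaryGroup (Fin N → F) ℂ) :=
    { carrier := {U | ∃ a ∈ A, ∃ b ∈ dual D,
        (U : Matrix (Fin N → F) (Fin N → F) ℂ) = opX a * opZ b}
      one_mem' := ⟨0, A.zero_mem, 0, (dual D).zero_mem, opX_zero_mul_opZ_zero.symm⟩
      mul_mem' := by
        rintro U V ⟨a, ha, b, hb, h⟩ ⟨a', ha', b', hb', h'⟩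
        refine ⟨a + a', A.add_mem ha ha', b + b', (dual D).add_mem hb hb', ?_⟩
        rw [Submonoid.coe_mul, h, h', opX_mul_opZ_mul, horth a' ha' b hb,
          AddChar.map_zero_eq_one, one_smul]
      inv_mem' := by
        rintro U ⟨a, ha, b, hb, h⟩
        refine ⟨-a, A.neg_mem ha, -b, (dual D).neg_mem hb, ?_⟩
        change star (U : Matrix (Fin N → F) (Fin N → F) ℂ) = _
        rw [h, star_opX_mul_opZ, horth a ha b hb, AddChar.map_zero_eq_one, one_smul] }
  refine ⟨S, ?_, fun v => ⟨?_, fun h => ⟨fun x hx => ?_, fun a ha x => ?_⟩⟩⟩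
  · rintro U ⟨a, -, b, -, h⟩
    exact ⟨0, a, b, by rw [h, AddChar.map_zero_eq_one, one_smul]⟩
  · rintro hv U ⟨a, ha, b, hb, h⟩
    ext x
    rw [h, opX_mul_opZ_mulVec, css_sub hv ha]
    by_cases hx : x ∈ D
    · rw [dotProduct_comm, hb _ (D.sub_mem hx (hAD ha)), AddChar.map_zero_eq_one, one_mul]
    · rw [hv.1 x hx, mul_zero]
  · obtain ⟨b, hb, hbx⟩ := exists_dotProduct_ne_zero hx
    obtain ⟨b', hb', h1⟩ := exists_psi_dotProduct_ne_one hb hbx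
    have h2 := congrFun (h ⟨_, opX_mul_opZ_mem_unitaryGroup 0 b'⟩
      ⟨0, A.zero_mem, b', hb', rfl⟩) x
    rw [opX_mul_opZ_mulVec, sub_zero] at h2
    by_contra hvx
    exact h1 (mul_right_cancel₀ hvx (h2.trans (one_mul _).symm))
  · have h2 := congrFun (h ⟨_, opX_mul_opZ_mem_unitaryGroup a 0⟩
      ⟨a, ha, 0, (dual D).zero_mem, rfl⟩) (x + a)
    rw [opX_mul_opZ_mulVec, add_sub_cancel_right, zero_dotProduct, AddChar.map_zero_eq_one,
      one_mul] at h2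
    exact h2.symm

/-- A vector of the CSS code is the same as a function on the cosets of `A` in `D`. -/
def cssEquiv (hAD : A ≤ D) : css A D ≃ₗ[ℂ] ((D ⧸ A.submoduleOf D) → ℂ) where
  toFun f := Quotient.lift (fun x : D => f.1 x) (by
    intro x y h
    have h1 : (x - y : Fin N → F) ∈ A := (Submodule.quotientRel_def (A.submoduleOf D)).1 h
    have h2 := f.2.2 _ h1 y
    rw [add_sub_cancel] at h2
    exact h2)
  map_add' f g := by
    ext x
    induction x using Quotient.inductionOn
    rfl
  map_smul' c f := by
    ext x
    induction x using Quotient.inductionOn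
    rfl
  invFun g := ⟨by
    classical
    exact fun x => if h : x ∈ D then g (Submodule.Quotient.mk ⟨x, h⟩) else 0, by
    constructor
    · intro x hx
      exact dif_neg hx
    · intro a ha x
      by_cases hx : x ∈ D
      · have hxa := D.add_mem hx (hAD ha)
        refine (dif_pos hxa).trans (Eq.trans ?_ (dif_pos hx).symm)
        congr 1
        rw [Submodule.Quotient.eq]
        change x + a - x ∈ A
        rwa [add_sub_cancel_left]
      · have hxa : x + a ∉ D := by rwa [D.add_mem_iff_left (hAD ha)]
        simp only [dif_neg hx, dif_neg hxa]⟩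
  left_inv f := by
    ext x
    by_cases hx : x ∈ D
    · exact dif_pos hx
    · exact (dif_neg hx).trans (f.2.1 x hx).symm
  right_inv g := by
    ext x
    induction x using Quotient.inductionOn with
    | h x => exact dif_pos x.2

theorem finrank_css (hAD : A ≤ D) :
    Module.finrank ℂ (css A D) = Fintype.card F ^ (Module.finrank F D - Module.finrank F A) := by
  classical
  have : Fintype (D ⧸ A.submoduleOf D) := Fintype.ofFinite _
  rw [(cssEquiv hAD).finrank_eq, Module.finrank_fintype_fun_eq_card,
    Module.card_eq_pow_finrank (K := F)]
  congr 1
  have h := Submodule.finrank_quotient_add_finrank (A.submoduleOf D)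
  rw [(Submodule.submoduleOfEquivOfLe hAD).finrank_eq] at h
  omega

theorem hammingNorm_le_card {x : Fin N → F} {T : Finset (Fin N)} (h : ∀ i, i ∉ T → x i = 0) :
    hammingNorm x ≤ T.card := by
  refine Finset.card_le_card fun i hi => ?_
  by_contra hT
  exact (Finset.mem_filter.1 hi).2 (h i hT)

/-- The vectors that vanish on `T`. -/
def vanishingOn (F : Type*) [Field F] (T : Finset (Fin N)) : Submodule F (Fin N → F) where
  carrier := {x | ∀ i ∈ T, x i = 0}
  add_mem' := by
    intro x y hx hy i hi
    simp [hx i hi, hy i hi]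
  zero_mem' := by simp
  smul_mem' := by
    intro c x hx i hi
    simp [hx i hi]

theorem eq_zero_of_mem_dual_vanishingOn {T : Finset (Fin N)} {x : Fin N → F}
    (hx : x ∈ dual (vanishingOn F T)) {i : Fin N} (hi : i ∉ T) : x i = 0 := by
  have h := hx (Pi.single i 1) fun j hj => by
    rw [Pi.single_eq_of_ne]
    rintro rfl
    exact hi hj
  rwa [single_one_dotProduct] at h

/-- If `A^⊥ \ D^⊥` has no word supported on `T`, then `A` and `D` have the same restriction
to `T`. -/
theorem le_sup_vanishingOn {T : Finset (Fin N)}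
    (h : ∀ z ∈ dual A, z ∉ dual D → T.card < hammingNorm z) : D ≤ A ⊔ vanishingOn F T := by
  -- In dual form, a word of `A^⊥` that is supported on `T` must lie in `D^⊥`.
  rw [← dual_dual (A ⊔ vanishingOn F T), ← dual_dual D, dual_sup]
  refine dual_le_dual ?_
  rintro z ⟨hzA, hzT⟩
  by_contra hz
  have h1 : hammingNorm z ≤ T.card :=
    hammingNorm_le_card fun i hi => eq_zero_of_mem_dual_vanishingOn hzT hi
  exact absurd (h z hzA hz) (by omega)

theorem ActsOn.eq_zero {T : Finset (Fin N)} {E : Matrix (Fin N → F) (Fin N → F) ℂ}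
    (hE : ActsOn T E) {x y : Fin N → F} {i : Fin N} (hi : i ∉ T) (hxy : x i ≠ y i) :
    E x y = 0 := by
  obtain ⟨B, hB⟩ := hE
  rw [hB, if_neg]
  exact fun h => hxy (h i hi)

theorem ActsOn.apply_add {T : Finset (Fin N)} {E : Matrix (Fin N → F) (Fin N → F) ℂ}
    (hE : ActsOn T E) {s : Fin N → F} (hs : s ∈ vanishingOn F T) (x y : Fin N → F) :
    E (x + s) (y + s) = E x y := by
  obtain ⟨B, hB⟩ := hE
  have h : ∀ z : Fin N → F, (fun i : T => (z + s) i) = fun i : T => z i := fun z => by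
    ext i
    simp [hs i i.2]
  rw [hB, hB, h, h]
  simp

/-- The hypothesis `hX` leaves only matrix entries between points of the same coset of `A`, so that
`E` acts on the code like the diagonal operator `G`. The hypothesis `hZ` then makes the average of
`G` over a coset of `A` the same for all cosets in `D`. -/
theorem detects_css {T : Finset (Fin N)}
    (hX : ∀ w ∈ D, w ∉ A → T.card < hammingNorm w)
    (hZ : ∀ z ∈ dual A, z ∉ dual D → T.card < hammingNorm z)
    {E : Matrix (Fin N → F) (Fin N → F) ℂ} (hE : ActsOn T E) : Detects (css A D) E := by
  classical
  let G : (Fin N → F) → ℂ := fun y => ∑ x, if x - y ∈ A then E x y else 0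
  have hG : ∀ s ∈ vanishingOn F T, ∀ y, G (y + s) = G y := by
    intro s hs y
    refine (Fintype.sum_equiv (Equiv.addRight s) _ _ fun x => ?_).symm
    simp only [Equiv.coe_addRight, add_sub_add_right_eq_sub, hE.apply_add hs]
  -- Modulo `A`, every `y ∈ D` is a vector that vanishes on `T`, and `G` does not see such a vector.
  have hsum : ∀ y ∈ D, ∑ a : A, G (y + a) = ∑ a : A, G a := by
    intro y hy
    obtain ⟨a₀, ha₀, s, hs, rfl⟩ := Submodule.mem_sup.1 (le_sup_vanishingOn hZ hy)
    refine Fintype.sum_equiv (Equiv.addLeft (⟨a₀, ha₀⟩ : A)) _ _ fun a => ?_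
    rw [add_right_comm, hG s hs]
    rfl
  refine ⟨(Fintype.card A : ℂ)⁻¹ * ∑ a : A, G a, fun u hu v hv => ?_⟩
  have hstep : star u ⬝ᵥ (E *ᵥ v) = ∑ y, star (u y) * v y * G y := by
    simp only [dotProduct, Matrix.mulVec, G, Finset.mul_sum]
    rw [Finset.sum_comm]
    refine Finset.sum_congr rfl fun y _ => Finset.sum_congr rfl fun x _ => ?_
    rw [Pi.star_apply]
    by_cases hvy : v y = 0
    · simp [hvy]
    by_cases hExy : E x y = 0
    · simp [hExy]
    have hyD : y ∈ D := by
      by_contra h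
      exact hvy (hv.1 y h)
    have hwt : hammingNorm (x - y) ≤ T.card := hammingNorm_le_card fun i hi => by
      by_contra h
      exact hExy (hE.eq_zero hi fun h' => h (by simp [h']))
    by_cases hxy : x - y ∈ A
    · have : u x = u y := by
        have := hu.2 _ hxy y
        rwa [add_sub_cancel] at this
      rw [if_pos hxy, this]
      ring
    -- Otherwise `x - y` would be a word of `D \ A` of weight at most `|T|`.
    · have hx : x ∉ D := fun hx => absurd (hX _ (D.sub_mem hx hyD) hxy) (by omega)
      rw [if_neg hxy, hu.1 x hx]
      simp
  -- Codewords are invariant under `A`, so `G` may be replaced by its average over `A`.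
  have htrans : ∀ a : A, ∑ y, star (u y) * v y * G y = ∑ y, star (u y) * v y * G (y + a) := by
    intro a
    refine (Fintype.sum_equiv (Equiv.addRight (a : Fin N → F)) _ _ fun y => ?_).symm
    simp only [Equiv.coe_addRight]
    rw [hu.2 a a.2, hv.2 a a.2]
  have hcard : (Fintype.card A : ℂ) ≠ 0 := Nat.cast_ne_zero.2 Fintype.card_ne_zero
  have key : (Fintype.card A : ℂ) * ∑ y, star (u y) * v y * G y =
      (∑ a : A, G a) * (star u ⬝ᵥ v) := by
    calc (Fintype.card A : ℂ) * ∑ y, star (u y) * v y * G y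
        = ∑ _a : A, ∑ y, star (u y) * v y * G y := by simp
      _ = ∑ a : A, ∑ y, star (u y) * v y * G (y + a) :=
          Finset.sum_congr rfl fun a _ => htrans a
      _ = ∑ y, star (u y) * v y * ∑ a : A, G (y + a) := by
          rw [Finset.sum_comm]
          simp only [Finset.mul_sum]
      _ = ∑ y, star (u y) * v y * ∑ a : A, G a := by
          refine Finset.sum_congr rfl fun y _ => ?_
          by_cases hy : y ∈ D
          · rw [hsum y hy]
          · simp [hv.1 y hy]
      _ = (∑ a : A, G a) * (star u ⬝ᵥ v) := by
          rw [← Finset.sum_mul, mul_comm]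
          rfl
  rw [hstep, mul_assoc, ← key, inv_mul_cancel_left₀ hcard]

/-- An operator `X(a)Z(b)` with `a ∉ D` or `b ∉ A^⊥` maps the CSS code to its orthogonal
complement. -/
theorem css_orthogonal {a b : Fin N → F} (h : a ∉ D ∨ b ∉ dual A)
    {u v : (Fin N → F) → ℂ} (hu : u ∈ css A D) (hv : v ∈ css A D) :
    star u ⬝ᵥ ((opX a * opZ b) *ᵥ v) = 0 := by
  simp only [dotProduct, opX_mul_opZ_mulVec, Pi.star_apply]
  rcases h with h | h
  · refine Finset.sum_eq_zero fun x _ => ?_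
    by_cases hx : x ∈ D
    · have : x - a ∉ D := fun h' => h (by simpa using D.sub_mem hx h')
      rw [hv.1 _ this, mul_zero, mul_zero]
    · simp [hu.1 x hx]
  · rw [mem_dual] at h
    push Not at h
    obtain ⟨c, hc, hcb⟩ := h
    obtain ⟨c', hc', h1⟩ := exists_psi_dotProduct_ne_one hc hcb
    rw [dotProduct_comm] at h1
    set S := ∑ x, star (u x) * (psi F (b ⬝ᵥ (x - a)) * v (x - a)) with hS
    -- Translating the summation variable by `c' ∈ A` preserves `u` and `v` but multiplies the phase
    -- by `ψ(⟨b, c'⟩) ≠ 1`.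
    have h2 : S = psi F (b ⬝ᵥ c') * S := by
      conv_lhs => rw [hS]
      rw [hS, Finset.mul_sum]
      refine (Fintype.sum_equiv (Equiv.addRight c') _ _ fun x => ?_).symm
      have : x + c' - a = x - a + c' := by abel
      rw [Equiv.coe_addRight, hu.2 c' hc', this, hv.2 c' hc', dotProduct_add,
        AddChar.map_add_eq_mul]
      ring
    by_contra hne
    exact h1 (mul_right_cancel₀ hne (h2.symm.trans (one_mul S).symm))

/-- A word of `D \ A` bounds the minimum distance of the CSS code. -/
theorem DistanceAtLeast.le_hammingNorm_of_mem (hAD : A ≤ D) {m : ℕ}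
    (hm : DistanceAtLeast (css A D) m) {w : Fin N → F} (hwD : w ∈ D) (hwA : w ∉ A) :
    m ≤ hammingNorm w := by
  classical
  by_contra hlt
  push Not at hlt
  obtain ⟨c, hc⟩ := hm.1 (Finset.univ.filter fun i => w i ≠ 0) hlt (opX w * opZ 0)
    (actsOn_opX_mul_opZ w 0 _ (by simp) (by simp))
  have hX : ∀ y, (opX w * opZ 0) *ᵥ cosetVec A y = cosetVec A (y + w) := by
    intro y
    ext x
    rw [opX_mul_opZ_mulVec, zero_dotProduct, AddChar.map_zero_eq_one, one_mul]
    simp only [cosetVec]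
    rw [sub_sub, add_comm w y]
  have h0 := cosetVec_mem_css hAD D.zero_mem
  have hw := cosetVec_mem_css hAD hwD
  have horth : star (cosetVec A 0) ⬝ᵥ cosetVec A w = 0 := by
    refine Finset.sum_eq_zero fun x _ => ?_
    simp only [cosetVec, Pi.star_apply, sub_zero]
    by_cases hx : x ∈ A
    · have : x - w ∉ A := fun h => hwA (by
        have := A.sub_mem hx h
        rwa [sub_sub_cancel] at this)
      rw [if_neg this, mul_zero]
    · rw [if_neg hx, star_zero, zero_mul]
  have h1 := hc _ h0 _ h0
  rw [hX, zero_add, horth] at h1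
  -- `X(w)` carries the coset vector of `0` to the orthogonal one of `w`, so the scalar must vanish.
  -- The pairing with the coset vector of `w` shows that it cannot.
  have hc0 : c = 0 := by
    rcases mul_eq_zero.1 h1.symm with h | h
    · exact h
    · exact absurd h (star_cosetVec_dotProduct_self_ne_zero 0)
  have h2 := hc _ hw _ h0
  rw [hX, zero_add, hc0, zero_mul] at h2
  exact star_cosetVec_dotProduct_self_ne_zero w h2

/-- A word of `A^⊥ \ D^⊥` bounds the minimum distance of the CSS code. -/
theorem DistanceAtLeast.le_hammingNorm_of_mem_dual (hAD : A ≤ D) {m : ℕ}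
    (hm : DistanceAtLeast (css A D) m) {z : Fin N → F} (hzA : z ∈ dual A) (hzD : z ∉ dual D) :
    m ≤ hammingNorm z := by
  classical
  by_contra hlt
  push Not at hlt
  obtain ⟨c, hc⟩ := hm.1 (Finset.univ.filter fun i => z i ≠ 0) hlt (opX 0 * opZ z)
    (actsOn_opX_mul_opZ 0 z _ (by simp) (by simp))
  have hZ : ∀ y, (opX 0 * opZ z) *ᵥ cosetVec A y = psi F (z ⬝ᵥ y) • cosetVec A y := by
    intro y
    ext x
    rw [opX_mul_opZ_mulVec, sub_zero, Pi.smul_apply, smul_eq_mul]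
    simp only [cosetVec]
    by_cases hx : x - y ∈ A
    · have := hzA _ hx
      rw [sub_dotProduct, sub_eq_zero, dotProduct_comm, dotProduct_comm y] at this
      rw [this]
    · simp [hx]
  -- Coset vectors are eigenvectors of `Z(z)`, and detection makes their eigenvalues agree on `D`.
  -- This contradicts `z ∉ D^⊥`.
  have hval : ∀ y ∈ D, psi F (z ⬝ᵥ y) = c := by
    intro y hy
    have h1 := hc _ (cosetVec_mem_css hAD hy) _ (cosetVec_mem_css hAD hy)
    rw [hZ, dotProduct_smul, smul_eq_mul] at h1
    exact mul_right_cancel₀ (star_cosetVec_dotProduct_self_ne_zero y) h1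
  have hc1 : c = 1 := by
    rw [← hval 0 D.zero_mem, dotProduct_zero, AddChar.map_zero_eq_one]
  rw [mem_dual] at hzD
  push Not at hzD
  obtain ⟨y, hy, hyz⟩ := hzD
  obtain ⟨y', hy', h1⟩ := exists_psi_dotProduct_ne_one hy hyz
  rw [dotProduct_comm] at h1
  exact h1 ((hval y' hy').trans hc1)

/-- For `A = D` a nonzero word of `A` bounds the minimum distance of the CSS code. -/
theorem DistanceAtLeast.le_hammingNorm_of_mem_self {m : ℕ}
    (hm : DistanceAtLeast (css A A) m) {w : Fin N → F} (hw : w ∈ A) (hw0 : w ≠ 0) :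
    m ≤ hammingNorm w := by
  by_contra hlt
  push Not at hlt
  have hswt : swt w 0 = hammingNorm w := by
    simp [swt, hammingNorm]
  have hdim : Module.finrank ℂ (css A A) = 1 := by rw [finrank_css le_rfl]; simp
  have h0 := cosetVec_mem_css (le_refl A) A.zero_mem
  have h := hm.2 hdim w 0 (by rw [hswt]; exact hammingNorm_pos_iff.2 hw0) (by rwa [hswt])
    _ h0 _ h0
  have hX : (opX w * opZ 0) *ᵥ cosetVec A 0 = cosetVec A 0 := by
    ext x
    rw [opX_mul_opZ_mulVec, zero_dotProduct, AddChar.map_zero_eq_one, one_mul, css_sub h0 hw]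
  rw [hX] at h
  exact star_cosetVec_dotProduct_self_ne_zero 0 h

/-- The purity clause is vacuous here, because `A ≠ D` makes the dimension greater than one. -/
theorem distanceAtLeast_css (hAD : A ≤ D) (hne : A ≠ D) {m : ℕ}
    (hX : ∀ w ∈ D, w ∉ A → m ≤ hammingNorm w)
    (hZ : ∀ z ∈ dual A, z ∉ dual D → m ≤ hammingNorm z) : DistanceAtLeast (css A D) m := by
  refine ⟨fun T hT E hE => detects_css (fun w hw hw' => hT.trans_le (hX w hw hw'))
    (fun z hz hz' => hT.trans_le (hZ z hz hz')) hE, fun h => ?_⟩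
  have hlt := Submodule.finrank_lt_finrank_of_lt (lt_of_le_of_ne hAD hne)
  have h1 := Nat.one_lt_pow (n := Module.finrank F D - Module.finrank F A) (by omega)
    (Fintype.one_lt_card (α := F))
  rw [finrank_css hAD] at h
  omega

/-- Detection is automatic for `A = D`. For purity, a nontrivial `X(a)Z(b)` of weight below `m`
cannot have both `a ∈ A` and `b ∈ A^⊥`, since the weights of `a` and `b` are at most that of the
operator. -/
theorem distanceAtLeast_css_self {m : ℕ} (hX : ∀ w ∈ A, w ≠ 0 → m ≤ hammingNorm w)
    (hZ : ∀ z ∈ dual A, z ≠ 0 → m ≤ hammingNorm z) : DistanceAtLeast (css A A) m := by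
  refine ⟨fun T hT E hE => detects_css (fun w hw hw' => absurd hw hw')
    (fun z hz hz' => absurd hz hz') hE, fun _ a b hpos hlt u hu v hv => ?_⟩
  refine css_orthogonal ?_ hu hv
  by_contra! hab
  have ha : hammingNorm a ≤ swt a b := Finset.card_le_card fun i hi => by
    simp only [ne_eq, Finset.mem_filter, Finset.mem_univ, true_and, Prod.mk.injEq] at hi ⊢
    exact fun h => hi h.1
  have hb : hammingNorm b ≤ swt a b := Finset.card_le_card fun i hi => by
    simp only [ne_eq, Finset.mem_filter, Finset.mem_univ, true_and, Prod.mk.injEq] at hi ⊢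
    exact fun h => hi h.2
  by_cases ha0 : a = 0
  · by_cases hb0 : b = 0
    · simp [ha0, hb0, swt] at hpos
    · have := hZ b hab.2 hb0
      omega
  · have := hX a hab.1 ha0
    omega

end CSS

/-! ### Minimum weights and distances with their default value -/

section Weights

variable {F : Type*} [Field F] [DecidableEq F] {n e : ℕ}

theorem hammingNorm_le (x : Fin n → F) : hammingNorm x ≤ n :=
  hammingNorm_le_card_fintype.trans_eq (Fintype.card_fin n)

theorem minWeight_le_hammingNorm {S : Set (Fin n → F)} {x : Fin n → F} (hx : x ∈ S) (h0 : x ≠ 0) :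
    minWeight S ≤ hammingNorm x := by
  rw [minWeight, if_pos ⟨x, hx, h0⟩]
  exact Nat.sInf_le ⟨x, hx, h0, rfl⟩

theorem minWeight_le (S : Set (Fin n → F)) : minWeight S ≤ n := by
  by_cases h : ∃ x ∈ S, x ≠ 0
  · obtain ⟨x, hx, h0⟩ := h
    exact (minWeight_le_hammingNorm hx h0).trans (hammingNorm_le x)
  · rw [minWeight, if_neg h]

theorem le_minWeight {S : Set (Fin n → F)} {m : ℕ} (hm : m ≤ n)
    (h : ∀ x ∈ S, x ≠ 0 → m ≤ hammingNorm x) : m ≤ minWeight S := by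
  rw [minWeight]
  split_ifs with hS
  · obtain ⟨x, hx, h0⟩ := hS
    refine le_csInf ⟨_, x, hx, h0, rfl⟩ ?_
    rintro w ⟨y, hy, hy0, rfl⟩
    exact h y hy hy0
  · exact hm

/-- This includes the case of no nonzero words in `S`, since the default value `n` is at least every
weight. -/
theorem minWeight_anti {S T : Set (Fin n → F)} (h : S ⊆ T) : minWeight T ≤ minWeight S :=
  le_minWeight (minWeight_le T) fun _ hx h0 => minWeight_le_hammingNorm (h hx) h0

theorem minDist_le_minWeight {W : Submodule F (Fin n → F)} :
    minDist (W : Set (Fin n → F)) ≤ minWeight (W : Set (Fin n → F)) := by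
  rw [minWeight]
  split_ifs with h
  · obtain ⟨x, hx, h0⟩ := h
    refine le_csInf ⟨_, x, hx, h0, rfl⟩ ?_
    rintro w ⟨y, hy, hy0, rfl⟩
    rw [minDist, if_pos ⟨y, hy, 0, W.zero_mem, hy0⟩]
    exact Nat.sInf_le ⟨y, hy, 0, W.zero_mem, hy0, hammingDist_zero_right y⟩
  · rw [minDist, if_neg]
    rintro ⟨x, hx, y, hy, hxy⟩
    exact h ⟨x - y, W.sub_mem hx hy, sub_ne_zero.2 hxy⟩

theorem hammingNorm_append (u : Fin n → F) (v : Fin e → F) :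
    hammingNorm (Fin.append u v) = hammingNorm u + hammingNorm v := by
  simp only [hammingNorm, Finset.card_filter, Fin.sum_univ_add, Fin.append_left, Fin.append_right]

end Weights

/-! ### Lengthening by `e` coordinates -/

section Extension

variable {F : Type*} [Field F] {n e : ℕ}

theorem append_dotProduct_append (u u' : Fin n → F) (v v' : Fin e → F) :
    Fin.append u v ⬝ᵥ Fin.append u' v' = u ⬝ᵥ u' + v ⬝ᵥ v' := by
  simp only [dotProduct, Fin.sum_univ_add, Fin.append_left, Fin.append_right]

/-- The linear map `x ↦ (x | φ x)`. -/
def graphMap (φ : (Fin n → F) →ₗ[F] (Fin e → F)) : (Fin n → F) →ₗ[F] (Fin (n + e) → F) where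
  toFun x := Fin.append x (φ x)
  map_add' x y := by
    ext i
    refine Fin.addCases (fun i => ?_) (fun i => ?_) i <;> simp
  map_smul' c x := by
    ext i
    refine Fin.addCases (fun i => ?_) (fun i => ?_) i <;> simp

theorem graphMap_apply (φ : (Fin n → F) →ₗ[F] (Fin e → F)) (x : Fin n → F) :
    graphMap φ x = Fin.append x (φ x) := rfl

theorem append_inj {u u' : Fin n → F} {v v' : Fin e → F} (h : Fin.append u v = Fin.append u' v') :
    u = u' ∧ v = v' := by
  constructor
  · ext i
    simpa using congrFun h (Fin.castAdd e i)
  · ext i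
    simpa using congrFun h (Fin.natAdd n i)

theorem exists_eq_append (w : Fin (n + e) → F) :
    ∃ (u : Fin n → F) (v : Fin e → F), w = Fin.append u v :=
  ⟨_, _, (Fin.append_castAdd_natAdd).symm⟩

theorem append_zero_zero : Fin.append (0 : Fin n → F) (0 : Fin e → F) = 0 := by
  ext i
  refine Fin.addCases (fun i => ?_) (fun i => ?_) i <;> simp

theorem graphMap_injective (φ : (Fin n → F) →ₗ[F] (Fin e → F)) :
    Function.Injective (graphMap φ) := fun _ _ h => (append_inj h).1

/-- By `he`, the quotient `G / (C ∩ G)` has dimension `e`. The map `φ` is the projection onto it,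
identified with `F^e` and extended arbitrarily to `F^n`. -/
theorem exists_linearMap_of_finrank (C G : Submodule F (Fin n → F))
    (he : Module.finrank F G = e + Module.finrank F ↥(C ⊓ G)) :
    ∃ φ : (Fin n → F) →ₗ[F] (Fin e → F),
      (∀ x ∈ G, φ x = 0 ↔ x ∈ C) ∧ ∀ v, ∃ x ∈ G, φ x = v := by
  have h1 := Submodule.finrank_quotient_add_finrank (C.submoduleOf G)
  have h2 : Module.finrank F (C.submoduleOf G) = Module.finrank F ↥(C ⊓ G) := by
    rw [← Submodule.finrank_map_subtype_eq G (C.submoduleOf G), Submodule.submoduleOf,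
      Submodule.map_comap_subtype, inf_comm]
  have h3 : Module.finrank F (G ⧸ C.submoduleOf G) = Module.finrank F (Fin e → F) := by
    rw [Module.finrank_fin_fun]
    omega
  let eqv := LinearEquiv.ofFinrankEq _ _ h3
  obtain ⟨φ, hφ⟩ := LinearMap.exists_extend (eqv.toLinearMap ∘ₗ (C.submoduleOf G).mkQ)
  have happ : ∀ x : G, φ x = eqv (Submodule.Quotient.mk x) := fun x => LinearMap.congr_fun hφ x
  refine ⟨φ, fun x hx => ?_, fun v => ?_⟩
  · rw [happ ⟨x, hx⟩, LinearEquiv.map_eq_zero_iff, Submodule.Quotient.mk_eq_zero]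
    rfl
  · obtain ⟨y, hy⟩ := Submodule.Quotient.mk_surjective _ (eqv.symm v)
    exact ⟨y, y.2, by rw [happ, hy, LinearEquiv.apply_symm_apply]⟩

/-- The graph of `φ` on `G`. -/
def graphCode (G : Submodule F (Fin n → F)) (φ : (Fin n → F) →ₗ[F] (Fin e → F)) :
    Submodule F (Fin (n + e) → F) := G.map (graphMap φ)

/-- The sum of the graph of `φ` on `G` and the code `C`, padded with zeros. -/
def extCode (C G : Submodule F (Fin n → F)) (φ : (Fin n → F) →ₗ[F] (Fin e → F)) :
    Submodule F (Fin (n + e) → F) := graphCode G φ ⊔ C.map (graphMap 0)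

variable {C G : Submodule F (Fin n → F)} {φ : (Fin n → F) →ₗ[F] (Fin e → F)}

theorem append_mem_graphCode {u : Fin n → F} {v : Fin e → F} :
    Fin.append u v ∈ graphCode G φ ↔ u ∈ G ∧ φ u = v := by
  constructor
  · rintro ⟨x, hx, h⟩
    obtain ⟨rfl, rfl⟩ := append_inj h
    exact ⟨hx, rfl⟩
  · rintro ⟨hu, rfl⟩
    exact ⟨u, hu, rfl⟩

theorem graphCode_le_extCode : graphCode G φ ≤ extCode C G φ := le_sup_left

theorem append_zero_mem_extCode {c : Fin n → F} (hc : c ∈ C) :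
    Fin.append c 0 ∈ extCode C G φ :=
  Submodule.mem_sup_right ⟨c, hc, rfl⟩

theorem exists_of_append_mem_extCode {u : Fin n → F} {v : Fin e → F}
    (h : Fin.append u v ∈ extCode C G φ) : ∃ x ∈ G, u - x ∈ C ∧ φ x = v := by
  obtain ⟨_, ⟨x, hx, rfl⟩, _, ⟨c, hc, rfl⟩, h⟩ := Submodule.mem_sup.1 h
  have h1 : Fin.append (x + c) (φ x) = Fin.append u v := by
    rw [← h]
    ext i
    refine Fin.addCases (fun i => ?_) (fun i => ?_) i <;> simp [graphMap_apply]
  obtain ⟨rfl, rfl⟩ := append_inj h1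
  exact ⟨x, hx, by rwa [add_sub_cancel_left], rfl⟩

theorem finrank_graphCode : Module.finrank F (graphCode G φ) = Module.finrank F G :=
  (Submodule.equivMapOfInjective _ (graphMap_injective φ) G).finrank_eq.symm

/-- As `φ` vanishes on `G` exactly at `C ∩ G`, the two summands of the code meet in `(C ∩ G | 0)`.
-/
theorem finrank_extCode (hφ : ∀ x ∈ G, φ x = 0 ↔ x ∈ C) :
    Module.finrank F (extCode C G φ) + Module.finrank F ↥(C ⊓ G) =
      Module.finrank F G + Module.finrank F C := by
  have h := Submodule.finrank_sup_add_finrank_inf_eq (graphCode G φ) (C.map (graphMap 0))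
  have hinf : graphCode G φ ⊓ C.map (graphMap 0) = (C ⊓ G).map (graphMap 0) := by
    ext w
    constructor
    · rintro ⟨hw, c, hc, rfl⟩
      obtain ⟨hG, -⟩ := append_mem_graphCode.1 hw
      exact ⟨c, ⟨hc, hG⟩, rfl⟩
    · rintro ⟨c, ⟨hc, hG⟩, rfl⟩
      exact ⟨append_mem_graphCode.2 ⟨hG, (hφ c hG).2 hc⟩, c, hc, rfl⟩
  rw [hinf, ← (Submodule.equivMapOfInjective _ (graphMap_injective 0) C).finrank_eq,
    ← (Submodule.equivMapOfInjective _ (graphMap_injective 0) (C ⊓ G)).finrank_eq,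
    finrank_graphCode] at h
  exact h

theorem append_mem_dual_graphCode {u : Fin n → F} {v : Fin e → F} :
    Fin.append u v ∈ dual (graphCode G φ) ↔ ∀ x ∈ G, x ⬝ᵥ u + φ x ⬝ᵥ v = 0 := by
  constructor
  · intro h x hx
    rw [← append_dotProduct_append]
    exact h _ ⟨x, hx, rfl⟩
  · rintro h _ ⟨x, hx, rfl⟩
    rw [graphMap_apply, append_dotProduct_append]
    exact h x hx

theorem append_mem_dual_extCode {u : Fin n → F} {v : Fin e → F} :
    Fin.append u v ∈ dual (extCode C G φ) ↔
      Fin.append u v ∈ dual (graphCode G φ) ∧ u ∈ dual C := by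
  rw [extCode, dual_sup, Submodule.mem_inf]
  refine and_congr_right fun _ => ⟨fun h c hc => ?_, ?_⟩
  · have := h _ ⟨c, hc, rfl⟩
    rw [graphMap_apply, append_dotProduct_append] at this
    simpa using this
  · rintro h _ ⟨c, hc, rfl⟩
    rw [graphMap_apply, append_dotProduct_append, h c hc]
    simp

/-- The first part of a word of the dual of the graph code, given the kernel of `φ`. -/
theorem mem_dual_inf_of_append_mem_dual_graphCode (hφ : ∀ x ∈ G, φ x = 0 ↔ x ∈ C)
    {u : Fin n → F} {v : Fin e → F} (h : Fin.append u v ∈ dual (graphCode G φ)) :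
    u ∈ dual (C ⊓ G) := by
  rintro x ⟨hxC, hxG⟩
  have := append_mem_dual_graphCode.1 h x hxG
  rwa [(hφ x hxG).2 hxC, zero_dotProduct, add_zero] at this

end Extension

/-! ### Weights of the words of the extended codes -/

section Distance

variable {F : Type*} [Field F] [DecidableEq F] {n e : ℕ}
  {C G : Submodule F (Fin n → F)} {φ : (Fin n → F) →ₗ[F] (Fin e → F)}

theorem add_one_le_hammingNorm_append {u : Fin n → F} {v : Fin e → F} {m : ℕ} (hv : v ≠ 0)
    (h : m ≤ hammingNorm u) : m + 1 ≤ hammingNorm (Fin.append u v) := by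
  rw [hammingNorm_append]
  exact add_le_add h (hammingNorm_pos_iff.2 hv)

theorem hammingNorm_append_zero (u : Fin n → F) :
    hammingNorm (Fin.append u (0 : Fin e → F)) = hammingNorm u := by
  rw [hammingNorm_append, hammingNorm_zero, add_zero]

theorem le_hammingNorm_of_mem_extCode (hφ : ∀ x ∈ G, φ x = 0 ↔ x ∈ C) {w : Fin (n + e) → F}
    (hw : w ∈ extCode C G φ) (hw' : w ∉ graphCode G φ) :
    min (minWeight ((C : Set (Fin n → F)) \ ↑(C ⊓ G)))
      (minWeight (((C ⊔ G : Submodule F (Fin n → F)) : Set (Fin n → F)) \ ↑G) + 1) ≤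
      hammingNorm w := by
  obtain ⟨u, v, rfl⟩ := exists_eq_append w
  obtain ⟨x, hx, hux, rfl⟩ := exists_of_append_mem_extCode hw
  by_cases h0 : φ x = 0
  · have hxC := (hφ x hx).1 h0
    have huC : u ∈ C := by simpa using C.add_mem hux hxC
    have huG : u ∉ G := fun huG =>
      hw' (append_mem_graphCode.2 ⟨huG, by rw [h0, (hφ u huG).2 huC]⟩)
    refine (min_le_left _ _).trans ?_
    rw [h0, hammingNorm_append_zero]
    refine minWeight_le_hammingNorm ⟨huC, fun h => huG h.2⟩ ?_
    rintro rfl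
    exact huG G.zero_mem
  -- If `u ∈ G`, then `u - x ∈ C ∩ G` is killed by `φ`, so that `φ u = φ x` and the word lies on the
  -- graph.
  · have huG : u ∉ G := fun huG => by
      refine hw' (append_mem_graphCode.2 ⟨huG, ?_⟩)
      have := (hφ _ (G.sub_mem huG hx)).2 hux
      rwa [map_sub, sub_eq_zero] at this
    refine (min_le_right _ _).trans (add_one_le_hammingNorm_append h0 ?_)
    refine minWeight_le_hammingNorm ⟨?_, huG⟩ ?_
    · have := (C ⊔ G).add_mem (Submodule.mem_sup_left hux) (Submodule.mem_sup_right hx)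
      rwa [sub_add_cancel] at this
    · rintro rfl
      exact huG G.zero_mem

theorem le_hammingNorm_of_mem_dual_graphCode (hφ : ∀ x ∈ G, φ x = 0 ↔ x ∈ C)
    {z : Fin (n + e) → F} (hz : z ∈ dual (graphCode G φ)) (hz' : z ∉ dual (extCode C G φ)) :
    min (minWeight ((dual G : Set (Fin n → F)) \ ↑(dual G ⊓ dual C)))
      (minWeight (((dual G ⊔ dual C : Submodule F (Fin n → F)) : Set (Fin n → F)) \ ↑(dual C)) + 1)
      ≤ hammingNorm z := by
  obtain ⟨u, v, rfl⟩ := exists_eq_append z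
  have huC : u ∉ dual C := fun h => hz' (append_mem_dual_extCode.2 ⟨hz, h⟩)
  have hu0 : u ≠ 0 := by
    rintro rfl
    exact huC (dual C).zero_mem
  by_cases h0 : v = 0
  · subst h0
    refine (min_le_left _ _).trans ?_
    rw [hammingNorm_append_zero]
    refine minWeight_le_hammingNorm ⟨fun x hx => ?_, fun h => huC h.2⟩ hu0
    simpa using append_mem_dual_graphCode.1 hz x hx
  · refine (min_le_right _ _).trans (add_one_le_hammingNorm_append h0 ?_)
    refine minWeight_le_hammingNorm ⟨?_, huC⟩ hu0
    -- The dual of `C ∩ G` is `C^⊥ + G^⊥`.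
    have := mem_dual_inf_of_append_mem_dual_graphCode hφ hz
    rwa [dual_inf, sup_comm] at this

theorem le_hammingNorm_of_mem_graphCode (hφ : ∀ x ∈ G, φ x = 0 ↔ x ∈ C) {w : Fin (n + e) → F}
    (hw : w ∈ graphCode G φ) (hw0 : w ≠ 0) :
    min (minWeight (C : Set (Fin n → F)))
      (minWeight ((C ⊔ G : Submodule F (Fin n → F)) : Set (Fin n → F)) + 1) ≤ hammingNorm w := by
  obtain ⟨u, v, rfl⟩ := exists_eq_append w
  obtain ⟨hu, rfl⟩ := append_mem_graphCode.1 hw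
  have hu0 : u ≠ 0 := by
    rintro rfl
    exact hw0 (by rw [map_zero, append_zero_zero])
  by_cases h0 : φ u = 0
  · refine (min_le_left _ _).trans ?_
    rw [h0, hammingNorm_append_zero]
    exact minWeight_le_hammingNorm ((hφ u hu).1 h0) hu0
  · refine (min_le_right _ _).trans (add_one_le_hammingNorm_append h0 ?_)
    exact minWeight_le_hammingNorm (Submodule.mem_sup_right hu) hu0

theorem le_hammingNorm_of_mem_dual_graphCode_of_ne_zero (hφ : ∀ x ∈ G, φ x = 0 ↔ x ∈ C)
    (hsurj : ∀ v, ∃ x ∈ G, φ x = v) {z : Fin (n + e) → F} (hz : z ∈ dual (graphCode G φ))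
    (hz0 : z ≠ 0) :
    min (minWeight (dual G : Set (Fin n → F)))
      (minWeight ((dual G ⊔ dual C : Submodule F (Fin n → F)) : Set (Fin n → F)) + 1) ≤
      hammingNorm z := by
  obtain ⟨u, v, rfl⟩ := exists_eq_append z
  by_cases h0 : v = 0
  · subst h0
    refine (min_le_left _ _).trans ?_
    rw [hammingNorm_append_zero]
    refine minWeight_le_hammingNorm (fun x hx => ?_) ?_
    · simpa using append_mem_dual_graphCode.1 hz x hx
    · rintro rfl
      exact hz0 append_zero_zero
  · refine (min_le_right _ _).trans (add_one_le_hammingNorm_append h0 ?_)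
    refine minWeight_le_hammingNorm ?_ ?_
    · have := mem_dual_inf_of_append_mem_dual_graphCode hφ hz
      rwa [dual_inf, sup_comm] at this
    -- If `u = 0`, then `v` is orthogonal to `φ(G) = F^e`, hence zero.
    · rintro rfl
      refine h0 (dotProduct_eq_zero v fun y => ?_)
      obtain ⟨x, hx, rfl⟩ := hsurj y
      rw [dotProduct_comm]
      simpa using append_mem_dual_graphCode.1 hz x hx

end Distance

/-- A nonempty bounded set of minimum distance bounds has a greatest element. -/
theorem exists_isGreatest_distanceAtLeast {F : Type*} [Field F] [Fintype F] [DecidableEq F]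
    {N b m : ℕ} {Q : Submodule ℂ ((Fin N → F) → ℂ)} (hb : ∀ m, DistanceAtLeast Q m → m ≤ b)
    (hm : DistanceAtLeast Q m) : ∃ d, IsGreatest {m | DistanceAtLeast Q m} d ∧ m ≤ d ∧ d ≤ b := by
  have hbdd : BddAbove {m | DistanceAtLeast Q m} := ⟨b, fun m h => hb m h⟩
  have hmem := Nat.sSup_mem ⟨m, hm⟩ hbdd
  exact ⟨_, ⟨hmem, fun x hx => le_csSup hbdd hx⟩, le_csSup hbdd hm, hb _ hmem⟩

end QCode

end

/-! ### The quantum construction X -/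

theorem mainTheorem5 {F : Type*} [Field F] [Fintype F] [DecidableEq F]
    (n k₁ k₂ d₁ d₂ e : ℕ) (C₁ C₂ : Submodule F (Fin n → F))
    (h₁ : QCode.IsLinearCode C₁ k₁ d₁) (h₂ : QCode.IsLinearCode C₂ k₂ d₂)
    (he : (e : ℤ) = n - k₂ - Module.finrank F ↥(C₁ ⊓ QCode.dual C₂)) :
    (e : ℤ) = n - k₁ - Module.finrank F ↥(C₂ ⊓ QCode.dual C₁) ∧
    ∃ k d : ℕ, (k : ℤ) = k₁ + k₂ - n + e ∧
      (∃ Q : Submodule ℂ ((Fin (n + e) → F) → ℂ), QCode.IsStabilizerCodeWith Q k d) ∧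
      (0 < k →
        min (min (QCode.minWeight ((C₁ : Set (Fin n → F)) \ ↑(C₁ ⊓ QCode.dual C₂)))
                 (QCode.minWeight ((C₂ : Set (Fin n → F)) \ ↑(C₂ ⊓ QCode.dual C₁))))
            (min (QCode.minWeight (((C₁ ⊔ QCode.dual C₂ : Submodule F (Fin n → F)) :
                    Set (Fin n → F)) \ ↑(QCode.dual C₂)) + 1)
                 (QCode.minWeight (((C₂ ⊔ QCode.dual C₁ : Submodule F (Fin n → F)) :
                    Set (Fin n → F)) \ ↑(QCode.dual C₁)) + 1)) ≤ d) ∧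
      min (min d₁ d₂)
          (min (QCode.minDist ((C₁ ⊔ QCode.dual C₂ : Submodule F (Fin n → F)) :
                  Set (Fin n → F)) + 1)
               (QCode.minDist ((C₂ ⊔ QCode.dual C₁ : Submodule F (Fin n → F)) :
                  Set (Fin n → F)) + 1)) ≤
        min (min (QCode.minWeight ((C₁ : Set (Fin n → F)) \ ↑(C₁ ⊓ QCode.dual C₂)))
                 (QCode.minWeight ((C₂ : Set (Fin n → F)) \ ↑(C₂ ⊓ QCode.dual C₁))))
            (min (QCode.minWeight (((C₁ ⊔ QCode.dual C₂ : Submodule F (Fin n → F)) :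
                    Set (Fin n → F)) \ ↑(QCode.dual C₂)) + 1)
                 (QCode.minWeight (((C₂ ⊔ QCode.dual C₁ : Submodule F (Fin n → F)) :
                    Set (Fin n → F)) \ ↑(QCode.dual C₁)) + 1)) ∧
      min (min d₁ d₂)
          (min (QCode.minDist ((C₁ ⊔ QCode.dual C₂ : Submodule F (Fin n → F)) :
                  Set (Fin n → F)) + 1)
               (QCode.minDist ((C₂ ⊔ QCode.dual C₁ : Submodule F (Fin n → F)) :
                  Set (Fin n → F)) + 1)) ≤ d ∧
      d ≤ min (QCode.minWeight ((C₁ : Set (Fin n → F)) \ ↑(C₁ ⊓ QCode.dual C₂)))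
              (QCode.minWeight ((C₂ : Set (Fin n → F)) \ ↑(C₂ ⊓ QCode.dual C₁))) := by
  obtain ⟨hpos₁, rfl, rfl⟩ := h₁
  obtain ⟨hpos₂, rfl, rfl⟩ := h₂
  have hdual₂ := QCode.finrank_add_finrank_dual C₂
  have hdual₁ := QCode.finrank_add_finrank_dual C₁
  have hdual := QCode.finrank_add_finrank_dual (C₁ ⊓ QCode.dual C₂)
  rw [QCode.dual_inf, QCode.dual_dual, sup_comm] at hdual
  have hsup := Submodule.finrank_sup_add_finrank_inf_eq C₂ (QCode.dual C₁)
  have hle : Module.finrank F ↥(C₁ ⊓ QCode.dual C₂) ≤ Module.finrank F C₁ :=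
    Submodule.finrank_mono inf_le_left
  -- The two formulas for `e` agree because `C₂ + C₁^⊥` is the dual of `C₁ ∩ C₂^⊥`, so its dimension
  -- is `n - dim (C₁ ∩ C₂^⊥)`.
  refine ⟨by omega, ?_⟩
  obtain ⟨φ, hφ, hsurj⟩ := QCode.exists_linearMap_of_finrank (e := e) C₁ (QCode.dual C₂) (by omega)
  have hext := QCode.finrank_extCode hφ
  have hAD := QCode.graphCode_le_extCode (C := C₁) (φ := φ) (G := QCode.dual C₂)
  have hA := QCode.finrank_graphCode (φ := φ) (G := QCode.dual C₂)
  have hkdim : Module.finrank F (QCode.extCode C₁ (QCode.dual C₂) φ) -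
      Module.finrank F (QCode.graphCode (QCode.dual C₂) φ) =
      Module.finrank F C₁ - Module.finrank F ↥(C₁ ⊓ QCode.dual C₂) := by omega
  have hkZ : ((Module.finrank F C₁ - Module.finrank F ↥(C₁ ⊓ QCode.dual C₂) : ℕ) : ℤ) =
      Module.finrank F C₁ + Module.finrank F C₂ - n + e := by omega
  have hδ := min_le_min
    (min_le_min (QCode.minWeight_anti (S := (C₁ : Set (Fin n → F)) \ ↑(C₁ ⊓ QCode.dual C₂))
        Set.sdiff_subset)
      (QCode.minWeight_anti (S := (C₂ : Set (Fin n → F)) \ ↑(C₂ ⊓ QCode.dual C₁))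
        Set.sdiff_subset))
    (min_le_min
      (Nat.add_le_add_right (QCode.minDist_le_minWeight.trans (QCode.minWeight_anti
        (S := ((C₁ ⊔ QCode.dual C₂ : Submodule F (Fin n → F)) : Set (Fin n → F)) \
          ↑(QCode.dual C₂)) Set.sdiff_subset)) 1)
      (Nat.add_le_add_right (QCode.minDist_le_minWeight.trans (QCode.minWeight_anti
        (S := ((C₂ ⊔ QCode.dual C₁ : Submodule F (Fin n → F)) : Set (Fin n → F)) \
          ↑(QCode.dual C₁)) Set.sdiff_subset)) 1))
  -- By `hle` this subtraction is not truncated, which gives `k ≥ 0`.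
  refine ⟨Module.finrank F C₁ - Module.finrank F ↥(C₁ ⊓ QCode.dual C₂), ?_⟩
  by_cases hk : Module.finrank F C₁ = Module.finrank F ↥(C₁ ⊓ QCode.dual C₂)
  · have hC : C₁ ⊓ QCode.dual C₂ = C₁ := Submodule.eq_of_le_of_finrank_eq inf_le_left hk.symm
    have hDA : QCode.graphCode (QCode.dual C₂) φ = QCode.extCode C₁ (QCode.dual C₂) φ :=
      Submodule.eq_of_le_of_finrank_eq hAD (by omega)
    have hC₂ : C₂ ⊓ QCode.dual C₁ = C₂ := by
      refine inf_eq_left.2 ?_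
      rw [← QCode.dual_dual C₂]
      exact QCode.dual_le_dual (inf_eq_left.1 hC)
    -- The code has length `n + e`, but the upper bound to be proved is `n`. A nonzero word of `C₁`,
    -- padded with zeros, supplies it.
    obtain ⟨x, hx, hx0⟩ := C₁.exists_mem_ne_zero_of_ne_bot (by
      rintro rfl
      simp at hpos₁)
    obtain ⟨d, hd, hmd, hdn⟩ := QCode.exists_isGreatest_distanceAtLeast (b := n)
      (Q := QCode.css (QCode.graphCode (QCode.dual C₂) φ) (QCode.graphCode (QCode.dual C₂) φ))
      (fun m hm => by
        refine (hm.le_hammingNorm_of_mem_self (w := Fin.append x 0) ?_ ?_).trans ?_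
        · rw [hDA]
          exact QCode.append_zero_mem_extCode hx
        · intro h
          exact hx0 (QCode.append_inj (h.trans QCode.append_zero_zero.symm)).1
        · rw [QCode.hammingNorm_append_zero]
          exact QCode.hammingNorm_le x)
      (QCode.distanceAtLeast_css_self (m := min (min (QCode.minWeight (C₁ : Set (Fin n → F)))
          (QCode.minWeight (C₂ : Set (Fin n → F))))
          (min (QCode.minDist ((C₁ ⊔ QCode.dual C₂ : Submodule F (Fin n → F)) :
                  Set (Fin n → F)) + 1)
               (QCode.minDist ((C₂ ⊔ QCode.dual C₁ : Submodule F (Fin n → F)) :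
                  Set (Fin n → F)) + 1)))
        (fun w hw hw0 => by
          refine le_trans ?_ (QCode.le_hammingNorm_of_mem_graphCode hφ hw hw0)
          exact min_le_min (min_le_left _ _) ((min_le_left _ _).trans
            (Nat.add_le_add_right QCode.minDist_le_minWeight 1)))
        (fun z hz hz0 => by
          refine le_trans ?_
            (QCode.le_hammingNorm_of_mem_dual_graphCode_of_ne_zero hφ hsurj hz hz0)
          rw [QCode.dual_dual]
          exact min_le_min (min_le_right _ _) ((min_le_right _ _).trans
            (Nat.add_le_add_right QCode.minDist_le_minWeight 1))))
    -- Both difference sets are empty for `k = 0`, so their minimum weights take the default value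
    -- `n`, and `d ≤ n` suffices.
    refine ⟨d, hkZ, ⟨_, QCode.isStabilizerCode_css le_rfl, ?_, hd⟩, fun h => by omega, hδ,
      hmd, le_min (QCode.le_minWeight hdn ?_) (QCode.le_minWeight hdn ?_)⟩
    · rw [QCode.finrank_css le_rfl, hk, Nat.sub_self, Nat.sub_self]
    · rintro y ⟨hy, hy'⟩
      exact absurd (hC.symm ▸ hy) hy'
    · rintro y ⟨hy, hy'⟩
      exact absurd (hC₂.symm ▸ hy) hy'
  · have hne : QCode.graphCode (QCode.dual C₂) φ ≠ QCode.extCode C₁ (QCode.dual C₂) φ := by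
      intro h
      rw [← h] at hkdim
      omega
    obtain ⟨x, hx, hx'⟩ := SetLike.not_le_iff_exists.1 fun h : C₁ ≤ C₁ ⊓ QCode.dual C₂ =>
      hk (by rw [le_antisymm inf_le_left h])
    have hub : ∀ m, QCode.DistanceAtLeast (QCode.css (QCode.graphCode (QCode.dual C₂) φ)
        (QCode.extCode C₁ (QCode.dual C₂) φ)) m →
        (∀ x ∈ (C₁ : Set (Fin n → F)) \ ↑(C₁ ⊓ QCode.dual C₂), m ≤ hammingNorm x) ∧
        ∀ x ∈ (C₂ : Set (Fin n → F)) \ ↑(C₂ ⊓ QCode.dual C₁), m ≤ hammingNorm x := by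
      refine fun m hm => ⟨?_, ?_⟩
      · rintro x ⟨hx, hx'⟩
        rw [← QCode.hammingNorm_append_zero (e := e) x]
        exact hm.le_hammingNorm_of_mem hAD (QCode.append_zero_mem_extCode hx)
          fun h => hx' ⟨hx, (QCode.append_mem_graphCode.1 h).1⟩
      · rintro x ⟨hx, hx'⟩
        rw [← QCode.hammingNorm_append_zero (e := e) x]
        refine hm.le_hammingNorm_of_mem_dual hAD (QCode.append_mem_dual_graphCode.2 fun y hy => ?_)
          fun h => hx' ⟨hx, (QCode.append_mem_dual_extCode.1 h).2⟩
        rw [dotProduct_zero, add_zero, dotProduct_comm]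
        exact hy x hx
    have hub' : ∀ m, QCode.DistanceAtLeast (QCode.css (QCode.graphCode (QCode.dual C₂) φ)
        (QCode.extCode C₁ (QCode.dual C₂) φ)) m →
        m ≤ min (QCode.minWeight ((C₁ : Set (Fin n → F)) \ ↑(C₁ ⊓ QCode.dual C₂)))
          (QCode.minWeight ((C₂ : Set (Fin n → F)) \ ↑(C₂ ⊓ QCode.dual C₁))) := by
      intro m hm
      -- `C₂ \ C₁^⊥` is not known here to contain a word, so its default value `n` has to be covered
      -- by a word of `C₁ \ C₂^⊥`.
      have hmn : m ≤ n := ((hub m hm).1 x ⟨hx, hx'⟩).trans (QCode.hammingNorm_le x)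
      exact le_min (QCode.le_minWeight hmn fun y hy _ => (hub m hm).1 y hy)
        (QCode.le_minWeight hmn fun y hy _ => (hub m hm).2 y hy)
    obtain ⟨d, hd, hmd, hdb⟩ := QCode.exists_isGreatest_distanceAtLeast hub'
      (QCode.distanceAtLeast_css hAD hne
        (m := min (min (QCode.minWeight ((C₁ : Set (Fin n → F)) \ ↑(C₁ ⊓ QCode.dual C₂)))
                 (QCode.minWeight ((C₂ : Set (Fin n → F)) \ ↑(C₂ ⊓ QCode.dual C₁))))
            (min (QCode.minWeight (((C₁ ⊔ QCode.dual C₂ : Submodule F (Fin n → F)) :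
                    Set (Fin n → F)) \ ↑(QCode.dual C₂)) + 1)
                 (QCode.minWeight (((C₂ ⊔ QCode.dual C₁ : Submodule F (Fin n → F)) :
                    Set (Fin n → F)) \ ↑(QCode.dual C₁)) + 1)))
        (fun w hw hw' => le_trans (min_le_min (min_le_left _ _) (min_le_left _ _))
          (QCode.le_hammingNorm_of_mem_extCode hφ hw hw'))
        (fun z hz hz' => by
          have h := QCode.le_hammingNorm_of_mem_dual_graphCode hφ hz hz'
          rw [QCode.dual_dual] at h
          exact le_trans (min_le_min (min_le_right _ _) (min_le_right _ _)) h))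
    refine ⟨d, hkZ, ⟨_, QCode.isStabilizerCode_css hAD, ?_, hd⟩, fun _ => hmd, hδ,
      hδ.trans hmd, hdb⟩
    rw [QCode.finrank_css hAD, hkdim]
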